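/- Let $V$ and $H$ be infinite-dimensional real Hilbert spaces with $V\subset H\subset V'$, where $V'$ is the dual of $V$, $H$ is identified with its dual, and the embedding $V\subset H$ is dense and compact. Let $L:V\to V'$ be the duality mapping, $\langle Lu,\varphi\rangle=(u,\varphi)_V$, and let $g:V\to V'$ be linear, continuous, symmetric and semi-positive definite, i.e. $\langle gu,v\rangle=\langle gv,u\rangle$ and $\langle gu,u\rangle\ge 0$ for all $u,v\in V$. Let $0\le q<N$ be integers, let $A,D$ be real symmetric semi-positive definite $N\times N$ matrices, and let $\mathcal L=LI$, $\mathcal G=gI$ act componentwise on $V^N$. Consider the system $$U''+\mathcal L U+AU+D\mathcal G U'=0,\qquad U(0)=U_0,\quad U'(0)=U_1. \tag{1.2}$$ For $(U_0,U_1)\in (V\times H)^N$, a solution of (1.2) is a function $U\in C^0([0,\infty);V^N)\cap C^1([0,\infty);H^N)$ with $U(0)=U_0$, $U'(0)=U_1$ that satisfies the equation weakly: for every $\varphi\in V$, componentwise in $\mathbb R^N$ and for all $t\ge 0$, $$\frac{d}{dt}\Big(\langle U'(t),\varphi\rangle+D\langle \mathcal G U(t),\varphi\rangle\Big)=-\langle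 \mathcal L U(t)+AU(t),\varphi\rangle .$$ Theorem 2.5. Let $\widetilde C_q$ be a real matrix of order $(N-q)\times N$ of full row rank. Assume that there exist constants $M\ge 1$ and $\omega>0$ such that for all initial data $(U_0,U_1)\in (V\times H)^N$ the corresponding solution $U$ of (1.2) satisfies $$\|\widetilde C_q(U(t),U'(t))\|_{(V\times H)^{N-q}}\le Me^{-\omega t}\,\|(U_0,U_1)\|_{(V\times H)^N},\qquad t\ge 0 .$$ Then $$\operatorname{rank}(\widetilde C_q D)\ge N-q .$$ -/

import Mathlib

/-- The norm of `(V × H)^n`, with the product Hilbert space structure. -/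
noncomputable def energyNorm {V H : Type*} [NormedAddCommGroup V] [NormedAddCommGroup H]
    {n : ℕ} (u : Fin n → V) (v : Fin n → H) : ℝ :=
  Real.sqrt (∑ i, (‖u i‖ ^ 2 + ‖v i‖ ^ 2))

/-- The action of a real matrix on vectors with components in a real vector space `E`:
`(C u)ᵢ = ∑ⱼ Cᵢⱼ uⱼ`. -/
def matAct {E : Type*} [AddCommGroup E] [Module ℝ E] {m n : ℕ}
    (C : Matrix (Fin m) (Fin n) ℝ) (u : Fin n → E) : Fin m → E :=
  fun i => ∑ j, C i j • u j

/-- The duality mapping `L : V → V'`, `⟨L u, φ⟩ = (u, φ)_V`. -/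
noncomputable def dualityMap (V : Type*) [NormedAddCommGroup V] [InnerProductSpace ℝ V] :
    V →L[ℝ] StrongDual ℝ V :=
  innerSL ℝ

/-- The embedding `H ⊂ V'` obtained by identifying `H` with its dual:
`⟨h, φ⟩ = (h, ι φ)_H`, where `ι : V → H` is the embedding `V ⊂ H`. -/
noncomputable def pivot {V H : Type*} [NormedAddCommGroup V] [InnerProductSpace ℝ V]
    [NormedAddCommGroup H] [InnerProductSpace ℝ H] (ι : V →L[ℝ] H) :
    H →L[ℝ] StrongDual ℝ V :=
  (ContinuousLinearMap.precomp ℝ ι).comp (innerSL ℝ)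

/-- `U`, with time derivative `U'`, is the weak solution on `[0, ∞)` of the system
`U'' + 𝓛 U + A U + D 𝓖 U' = 0` with initial data `(U₀, U₁) ∈ (V × H)^N`:
`U ∈ C⁰([0, ∞), V^N) ∩ C¹([0, ∞), H^N)`, `U(0) = U₀`, `U'(0) = U₁`, and, for every component `i`
and every test vector `φ ∈ V`,
`d/dt ⟨(U' + D 𝓖 U)ᵢ, φ⟩ = - ⟨(𝓛 U + A U)ᵢ, φ⟩` at every time `t ≥ 0`. Since `g` does not depend on
time, the term `D 𝓖 U'` is the time derivative of `D 𝓖 U`; the value `U'(t)` itself is only in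
`H^N`, where `𝓖` is not defined. -/
structure IsWeakSolution {V H : Type*} [NormedAddCommGroup V] [InnerProductSpace ℝ V]
    [NormedAddCommGroup H] [InnerProductSpace ℝ H] {N : ℕ}
    (ι : V →L[ℝ] H) (g : V →L[ℝ] StrongDual ℝ V) (A D : Matrix (Fin N) (Fin N) ℝ)
    (U₀ : Fin N → V) (U₁ : Fin N → H) (U : ℝ → Fin N → V) (U' : ℝ → Fin N → H) : Prop where
  continuousOn : ContinuousOn U (Set.Ici 0)
  hasDerivWithinAt : ∀ t : ℝ, 0 ≤ t →
    HasDerivWithinAt (fun s => fun i => ι (U s i)) (U' t) (Set.Ici 0) t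
  continuousOn_deriv : ContinuousOn U' (Set.Ici 0)
  initial : U 0 = U₀
  initial_deriv : U' 0 = U₁
  weak : ∀ (i : Fin N) (φ : V) (t : ℝ), 0 ≤ t →
    HasDerivWithinAt
      (fun s => pivot ι (U' s i) φ + matAct D (fun j => g (U s j)) i φ)
      (-(dualityMap V (U t i) φ + pivot ι (matAct A (fun j => ι (U t j)) i) φ))
      (Set.Ici 0) t

/-!
If `rank (C D) < N - q`, there is `w ≠ 0` with `wᵀ C D = 0`, and `c = Cᵀ w ≠ 0` because `C` has
full row rank. Applying `c` to the system removes the damping: `u = c · U` solves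
`u'' + L u = - c · A U`, a conservative equation perturbed by a term that is compact, since `A U`
enters through the compact embedding `V ⊂ H`. As `u` is controlled by `C U`, the decay estimate
makes `u` decay uniformly exponentially, whatever the data. That is impossible
(`IsUndampedProjection.not_uniform_decay`): take data close to `(c vₙ, 0)` with `vₙ` bounded and
separated in the infinite-dimensional space `V`. On a fixed interval `[0, T]` the coupling terms
`c · A Uₙ` form a precompact set of functions with values in `H`, by boundedness of the energy
(`IsStrongSolution.energy_le`) and an Arzelà–Ascoli pigeonhole (`exists_ne_forall_norm_sub_le`), so
two of them are arbitrarily close. The difference of these two solutions has a projection whose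
energy is almost conserved on `[0, T]` (`IsUndampedProjection.energy_sub_le`) and is bounded below
at time `0`, while the decay estimate makes it small at time `T` if `T` is large.

The decay hypothesis speaks of weak solutions, so the argument needs enough of them
(`exists_isStrongSolution_near`): for a dense set of data there are strong solutions, for which the
energy identities can be differentiated directly. The resolvent `R` of the wave operator, suitably
shifted, exists by Lax–Milgram (`exists_resolvent`) and satisfies `‖R z‖² ≤ ⟪R z, z⟫`; for any
such bounded `R` a Yosida approximation produces trajectories of the semigroup generated by
`1 - R⁻¹` starting from the range of `R³` (`exists_trajectory`), without any mention of unbounded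
operators.
-/

/-! ### Evolution equations with a firmly nonexpansive resolvent -/

section Evolution

open Filter Topology
open scoped RealInnerProductSpace

variable {X : Type*} [NormedAddCommGroup X] [InnerProductSpace ℝ X]
  {R : X →L[ℝ] X}

theorem norm_apply_le_of_firmly_nonexpansive (hR : ∀ z, ‖R z‖ ^ 2 ≤ ⟪R z, z⟫) (z : X) :
    ‖R z‖ ≤ ‖z‖ := by
  have h1 := (hR z).trans (real_inner_le_norm _ _)
  by_contra! h
  nlinarith [norm_nonneg z]

theorem norm_sub_one_apply_le (hR : ∀ z, ‖R z‖ ^ 2 ≤ ⟪R z, z⟫) (x : X) :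
    ‖(R - 1) x‖ ≤ 2 * ‖x‖ := by
  have := norm_sub_le (R x) x
  have := norm_apply_le_of_firmly_nonexpansive hR x
  simp only [sub_apply, one_apply_eq_self]
  linarith

/-- The Yosida-type approximation `(R - 1) (R + ε)⁻¹` of the generator `1 - R⁻¹`. The
inverse is a genuine one for `ε > 0` if `‖R z‖² ≤ ⟪R z, z⟫`, see `isUnit_add_smul_one`. -/
noncomputable def yosidaApprox (R : X →L[ℝ] X) (ε : ℝ) : X →L[ℝ] X :=
  (R - 1) * Ring.inverse (R + ε • 1)

theorem commute_inverse_add_smul_one (ε : ℝ) : Commute R (Ring.inverse (R + ε • 1)) := by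
  have h : Commute R (R + ε • 1) :=
    (Commute.refl R).add_right ((Commute.one_right R).smul_right ε)
  by_cases hu : IsUnit (R + ε • (1 : X →L[ℝ] X))
  · obtain ⟨u, hu⟩ := hu
    rw [← hu, Ring.inverse_unit]
    exact (hu ▸ h : Commute R u).units_inv_right
  · rw [Ring.inverse_non_unit _ hu]
    exact Commute.zero_right R

theorem commute_yosidaApprox (ε : ℝ) : Commute R (yosidaApprox R ε) :=
  ((Commute.refl R).sub_right (Commute.one_right R)).mul_right (commute_inverse_add_smul_one ε)

theorem commute_yosidaApprox_yosidaApprox (ε δ : ℝ) :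
    Commute (yosidaApprox R ε) (yosidaApprox R δ) := by
  have h : ∀ ε : ℝ, Commute (R - 1) (Ring.inverse (R + ε • 1)) := fun ε =>
    (commute_inverse_add_smul_one ε).sub_left (Commute.one_left _)
  have h2 : Commute (Ring.inverse (R + ε • 1)) (Ring.inverse (R + δ • 1)) := by
    refine Commute.ringInverse_ringInverse ?_
    exact ((Commute.refl R).add_right ((Commute.one_right R).smul_right δ)).add_left
      ((Commute.one_left _).smul_left ε)
  exact (((Commute.refl _).mul_right (h δ))).mul_left ((h ε).symm.mul_right h2)

variable [CompleteSpace X]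

/-- A dissipative bounded operator generates a contraction semigroup. -/
theorem norm_exp_smul_apply_le_of_dissipative {B : X →L[ℝ] X} (hB : ∀ x, ⟪B x, x⟫ ≤ 0)
    {t : ℝ} (ht : 0 ≤ t) (x : X) : ‖NormedSpace.exp (t • B) x‖ ≤ ‖x‖ := by
  have hd : ∀ s : ℝ, HasDerivAt (fun s : ℝ => ‖NormedSpace.exp (s • B) x‖ ^ 2)
      (2 * ⟪NormedSpace.exp (s • B) x, B (NormedSpace.exp (s • B) x)⟫) s := fun s =>
    (((ContinuousLinearMap.apply ℝ X x).hasFDerivAt.comp_hasDerivAt s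
      (hasDerivAt_exp_smul_const' B s))).norm_sq
  have hanti : Antitone (fun s : ℝ => ‖NormedSpace.exp (s • B) x‖ ^ 2) := by
    refine antitone_of_hasDerivAt_nonpos hd fun s => ?_
    have := hB (NormedSpace.exp (s • B) x)
    rw [real_inner_comm] at this
    simp only [Pi.zero_apply]
    linarith
  have h := hanti ht
  simp only [zero_smul, NormedSpace.exp_zero, one_apply_eq_self] at h
  exact (sq_le_sq₀ (norm_nonneg _) (norm_nonneg _)).1 h

/-- Duhamel's comparison of two commuting contraction semigroups. -/
theorem norm_exp_smul_sub_exp_smul_le {B B' : X →L[ℝ] X} (hB : ∀ x, ⟪B x, x⟫ ≤ 0)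
    (hB' : ∀ x, ⟪B' x, x⟫ ≤ 0) (hcomm : Commute B B') {t : ℝ} (ht : 0 ≤ t) (x : X) :
    ‖NormedSpace.exp (t • B) x - NormedSpace.exp (t • B') x‖ ≤ ‖B x - B' x‖ * t := by
  let E : ℝ → X →L[ℝ] X := fun s => NormedSpace.exp (s • B)
  let E' : ℝ → X →L[ℝ] X := fun s => NormedSpace.exp (s • B')
  have hd : ∀ s : ℝ, HasDerivAt (fun s : ℝ => E' (t - s) (E s x))
      (E' (t - s) (E s (B x - B' x))) s := by
    intro s
    have h1 : HasDerivAt E (E s * B) s := hasDerivAt_exp_smul_const B s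
    have h2 : HasDerivAt (fun s => E' (t - s)) (-(E' (t - s) * B')) s := by
      have := (hasDerivAt_exp_smul_const B' (t - s)).scomp s ((hasDerivAt_id s).const_sub t)
      simpa [E', Function.comp_def] using this
    have h3 := (ContinuousLinearMap.apply ℝ X x).hasFDerivAt.comp_hasDerivAt s (h2.mul h1)
    have hc : B' * E s = E s * B' := by
      have : Commute B' (s • B) := (hcomm.symm).smul_right s
      exact this.exp_right
    refine h3.congr_deriv ?_
    have hc' : B' (E s x) = E s (B' x) := congrArg (fun T : X →L[ℝ] X => T x) hc
    simp [hc', sub_eq_add_neg, add_comm]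
  have hb : ∀ s ∈ Set.Icc 0 t, ‖E' (t - s) (E s (B x - B' x))‖ ≤ ‖B x - B' x‖ := by
    intro s hs
    exact (norm_exp_smul_apply_le_of_dissipative hB' (sub_nonneg.2 hs.2) _).trans
      (norm_exp_smul_apply_le_of_dissipative hB hs.1 _)
  have := (convex_Icc (0 : ℝ) t).norm_image_sub_le_of_norm_hasDerivWithin_le
    (fun s _ => (hd s).hasDerivWithinAt) hb (Set.left_mem_Icc.2 ht) (Set.right_mem_Icc.2 ht)
  simpa [E, E', abs_of_nonneg ht] using this

theorem isUnit_add_smul_one (hR : ∀ z, ‖R z‖ ^ 2 ≤ ⟪R z, z⟫) {ε : ℝ} (hε : 0 < ε) :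
    IsUnit (R + ε • (1 : X →L[ℝ] X)) := by
  refine ContinuousLinearMap.isUnit_of_forall_le_norm_inner_map _ (c := ε.toNNReal)
    (Real.toNNReal_pos.2 hε) fun x => ?_
  have : ⟪(R + ε • (1 : X →L[ℝ] X)) x, x⟫ = ⟪R x, x⟫ + ε * ‖x‖ ^ 2 := by
    simp [inner_add_left, inner_smul_left]
  rw [this, Real.norm_eq_abs]
  refine le_trans ?_ (le_abs_self _)
  have := hR x
  rw [Real.coe_toNNReal _ hε.le]
  nlinarith [sq_nonneg ‖R x‖]

/-- With `x = (R + ε) z` the claim is `⟪R z - z, R z + ε z⟫ ≤ 0`, which follows from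
`‖R z‖² ≤ ⟪R z, z⟫ ≤ ‖z‖²`. -/
theorem yosidaApprox_dissipative (hR : ∀ z, ‖R z‖ ^ 2 ≤ ⟪R z, z⟫) {ε : ℝ} (hε : 0 < ε) (x : X) :
    ⟪yosidaApprox R ε x, x⟫ ≤ 0 := by
  set z := Ring.inverse (R + ε • (1 : X →L[ℝ] X)) x with hz
  have hx : x = R z + ε • z := by
    have := congrArg (fun T : X →L[ℝ] X => T x)
      (Ring.mul_inverse_cancel _ (isUnit_add_smul_one hR hε))
    simpa using this.symm
  have hB : yosidaApprox R ε x = R z - z := by simp [yosidaApprox, hz]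
  rw [hB, hx]
  have h1 := hR z
  have h2 := norm_apply_le_of_firmly_nonexpansive hR z
  have h3 := real_inner_le_norm (R z) z
  have h4 : ⟪z, R z⟫ = ⟪R z, z⟫ := real_inner_comm _ _
  simp only [inner_sub_left, inner_add_right, inner_smul_right, real_inner_self_eq_norm_sq, h4]
  have h5 : ⟪R z, z⟫ ≤ ‖z‖ ^ 2 := by nlinarith [norm_nonneg z]
  nlinarith

theorem norm_inverse_add_smul_one_apply_le (hR : ∀ z, ‖R z‖ ^ 2 ≤ ⟪R z, z⟫) {ε : ℝ} (hε : 0 < ε)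
    (x : X) : ‖Ring.inverse (R + ε • (1 : X →L[ℝ] X)) (R x)‖ ≤ ‖x‖ := by
  set S := Ring.inverse (R + ε • (1 : X →L[ℝ] X)) with hS
  have hx : x = R (S x) + ε • S x := by
    have := congrArg (fun T : X →L[ℝ] X => T x)
      (Ring.mul_inverse_cancel _ (isUnit_add_smul_one hR hε))
    simpa using this.symm
  have hc : S (R x) = R (S x) :=
    (congrArg (fun T : X →L[ℝ] X => T x) (commute_inverse_add_smul_one (R := R) ε).eq).symm
  rw [hc]
  have h1 := hR (S x)
  have h2 : ‖R (S x)‖ ^ 2 ≤ ⟪R (S x), x⟫ := by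
    have e : ⟪R (S x), x⟫ = ⟪R (S x), R (S x) + ε • S x⟫ := by rw [← hx]
    rw [e, inner_add_right, inner_smul_right, real_inner_self_eq_norm_sq]
    nlinarith [sq_nonneg ‖R (S x)‖]
  have h3 := h2.trans (real_inner_le_norm _ _)
  by_contra! h
  nlinarith [norm_nonneg x]

/-- On the range of `R` the approximation differs from the generator `R x ↦ R x - x` by a term
which is of order `ε` when `x` itself lies in the range of `R`. -/
theorem yosidaApprox_apply (hR : ∀ z, ‖R z‖ ^ 2 ≤ ⟪R z, z⟫) {ε : ℝ} (hε : 0 < ε) (x : X) :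
    yosidaApprox R ε (R x) =
      (R - 1) (x - ε • Ring.inverse (R + ε • (1 : X →L[ℝ] X)) x) := by
  set S := Ring.inverse (R + ε • (1 : X →L[ℝ] X)) with hS
  have h := congrArg (fun T : X →L[ℝ] X => T x)
      (Ring.inverse_mul_cancel _ (isUnit_add_smul_one hR hε))
  have h1 : S (R x) = x - ε • S x := by
    rw [eq_sub_iff_add_eq]
    simpa [← hS] using h
  rw [← h1]
  rfl

/-- Existence of smooth trajectories of the contraction semigroup whose generator is `1 - R⁻¹`
(Lumer–Phillips): writing the trajectory as `u = R w`, the equation is `u' = R w - w`. -/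
theorem exists_trajectory (hR : ∀ z, ‖R z‖ ^ 2 ≤ ⟪R z, z⟫) (y : X) :
    ∃ w : ℝ → X, Continuous w ∧ w 0 = R (R y) ∧
      ∀ t : ℝ, 0 ≤ t → HasDerivWithinAt (fun s => R (w s)) (R (w t) - w t) (Set.Ici 0) t := by
  let ε : ℕ → ℝ := fun n => 1 / ((n : ℝ) + 1)
  have hε : ∀ n, 0 < ε n := fun n => Nat.one_div_pos_of_nat
  have hε0 : Tendsto ε atTop (𝓝 0) := tendsto_one_div_add_atTop_nhds_zero_nat
  let B : ℕ → X →L[ℝ] X := fun n => yosidaApprox R (ε n)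
  have hB : ∀ n x, ⟪B n x, x⟫ ≤ 0 := fun n x => yosidaApprox_dissipative hR (hε n) x
  let S : ℕ → X →L[ℝ] X := fun n => Ring.inverse (R + ε n • (1 : X →L[ℝ] X))
  -- time is truncated at `0` because the semigroups are contractions only forward in time
  let W : ℕ → ℝ → X := fun n t => NormedSpace.exp ((max t 0) • B n) (R (R y))
  have hSW : ∀ n t, ‖S n (W n t)‖ ≤ ‖R y‖ := by
    intro n t
    have hc : Commute R (NormedSpace.exp ((max t 0) • B n)) :=
      ((commute_yosidaApprox (ε n)).smul_right _).exp_right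
    have h1 : W n t = R (NormedSpace.exp ((max t 0) • B n) (R y)) :=
      (congrArg (fun T : X →L[ℝ] X => T (R y)) hc.eq).symm
    rw [h1]
    exact (norm_inverse_add_smul_one_apply_le hR (hε n) _).trans
      (norm_exp_smul_apply_le_of_dissipative (hB n) (le_max_right _ _) _)
  have hBB : ∀ n m, ‖B n (R (R y)) - B m (R (R y))‖ ≤ 2 * (ε n + ε m) * ‖y‖ := by
    intro n m
    have e : ∀ n, B n (R (R y)) = (R - 1) (R y - ε n • S n (R y)) := fun n =>
      yosidaApprox_apply hR (hε n) _
    rw [e, e, ← map_sub]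
    refine (norm_sub_one_apply_le hR _).trans ?_
    have e2 : R y - ε n • S n (R y) - (R y - ε m • S m (R y)) =
      ε m • S m (R y) - ε n • S n (R y) := by abel
    rw [e2, mul_assoc]
    gcongr
    have a : ∀ n, ‖ε n • S n (R y)‖ ≤ ε n * ‖y‖ := fun n => by
      rw [norm_smul, Real.norm_of_nonneg (hε n).le]
      exact mul_le_mul_of_nonneg_left (norm_inverse_add_smul_one_apply_le hR (hε n) y) (hε n).le
    linarith [norm_sub_le (ε m • S m (R y)) (ε n • S n (R y)), a n, a m]
  -- `W n t` is Cauchy, because `hBB` feeds the comparison of the two semigroups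
  have hcauchy : ∀ t, CauchySeq fun n => W n t := by
    intro t
    rw [Metric.cauchySeq_iff']
    intro η hη
    set K := 4 * ‖y‖ * max t 0 with hK
    have hK0 : 0 ≤ K := by positivity
    obtain ⟨n₀, hn₀⟩ := (hε0.eventually (gt_mem_nhds (div_pos hη (by linarith : 0 < K + 1)))).exists
    refine ⟨n₀, fun n hn => ?_⟩
    have hle : ε n ≤ ε n₀ := Nat.one_div_le_one_div hn
    have h1 := norm_exp_smul_sub_exp_smul_le (hB n) (hB n₀)
      (commute_yosidaApprox_yosidaApprox _ _) (le_max_right t 0) (R (R y))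
    rw [dist_eq_norm]
    calc ‖W n t - W n₀ t‖ ≤ ‖B n (R (R y)) - B n₀ (R (R y))‖ * max t 0 := h1
      _ ≤ 2 * (ε n + ε n₀) * ‖y‖ * max t 0 := by gcongr; exact hBB n n₀
      _ ≤ 2 * (ε n₀ + ε n₀) * ‖y‖ * max t 0 := by gcongr
      _ = ε n₀ * K := by rw [hK]; ring
      _ ≤ ε n₀ * (K + 1) := by gcongr; linarith
      _ < η := (lt_div_iff₀ (by linarith)).1 hn₀
  choose w hw using fun t => cauchySeq_tendsto_of_complete (hcauchy t)
  have hWd : ∀ n t, HasDerivAt (fun s : ℝ => NormedSpace.exp (s • B n) (R (R y)))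
      (NormedSpace.exp (t • B n) (B n (R (R y)))) t := fun n t =>
    (ContinuousLinearMap.apply ℝ X (R (R y))).hasFDerivAt.comp_hasDerivAt t
      (hasDerivAt_exp_smul_const (B n) t)
  have hBn : ∀ n, ‖B n (R (R y))‖ ≤ 2 * ‖R y - ε n • S n (R y)‖ := fun n => by
    have e : B n (R (R y)) = (R - 1) (R y - ε n • S n (R y)) := yosidaApprox_apply hR (hε n) _
    rw [e]
    exact norm_sub_one_apply_le hR _
  have hεn1 : ∀ n, ε n ≤ 1 := fun n => by
    have : ε n ≤ ε 0 := Nat.one_div_le_one_div (Nat.zero_le n)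
    simpa [ε] using this
  have hBn' : ∀ n, ‖B n (R (R y))‖ ≤ 4 * ‖y‖ := fun n => by
    refine (hBn n).trans ?_
    have a : ‖ε n • S n (R y)‖ ≤ ‖y‖ := by
      rw [norm_smul, Real.norm_of_nonneg (hε n).le]
      calc ε n * ‖S n (R y)‖ ≤ 1 * ‖y‖ :=
        mul_le_mul (hεn1 n) (norm_inverse_add_smul_one_apply_le hR (hε n) y)
            (norm_nonneg _) zero_le_one
        _ = ‖y‖ := one_mul _
    linarith [norm_sub_le (R y) (ε n • S n (R y)), norm_apply_le_of_firmly_nonexpansive hR y]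
  -- the Lipschitz constant does not depend on `n`, so the limit inherits it
  have hWlip : ∀ n s t, ‖W n s - W n t‖ ≤ 4 * ‖y‖ * ‖s - t‖ := by
    intro n s t
    have h1 := (convex_Ici (0 : ℝ)).norm_image_sub_le_of_norm_hasDerivWithin_le
      (f := fun s : ℝ => NormedSpace.exp (s • B n) (R (R y)))
      (fun s _ => (hWd n s).hasDerivWithinAt)
      (fun s hs => (norm_exp_smul_apply_le_of_dissipative (hB n) hs _).trans (hBn' n))
      (x := max t 0) (y := max s 0) (Set.mem_Ici.2 (le_max_right _ _))
      (Set.mem_Ici.2 (le_max_right _ _))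
    refine h1.trans ?_
    gcongr
    exact abs_max_sub_max_le_abs s t 0
  have hwlip : ∀ s t, ‖w s - w t‖ ≤ 4 * ‖y‖ * ‖s - t‖ := fun s t =>
    le_of_tendsto ((hw s).sub (hw t)).norm (Eventually.of_forall fun n => hWlip n s t)
  have hwc : Continuous w := by
    have : LipschitzWith (4 * ‖y‖₊) w :=
      LipschitzWith.of_dist_le_mul fun s t => by
        simpa [dist_eq_norm] using hwlip s t
    exact this.continuous
  have hWc : ∀ n, Continuous (W n) := fun n => by
    have : LipschitzWith (4 * ‖y‖₊) (W n) :=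
      LipschitzWith.of_dist_le_mul fun s t => by
        simpa [dist_eq_norm] using hWlip n s t
    exact this.continuous
  have hw0 : w 0 = R (R y) := by
    refine tendsto_nhds_unique (hw 0) ?_
    simp [W]
  refine ⟨w, hwc, hw0, fun t ht => ?_⟩
  -- pointwise convergence suffices to pass to the limit in the integrated equation
  have hint : ∀ t, 0 ≤ t → R (w t) = R (w 0) + ∫ s in (0 : ℝ)..t, (R - 1) (w s) := by
    intro t ht
    have hn : ∀ n, R (W n t) =
        R (W n 0) + ∫ s in (0 : ℝ)..t, (R - 1) (W n s - ε n • S n (W n s)) := by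
      intro n
      have hd : ∀ s ∈ Set.uIcc 0 t, HasDerivAt
          (fun s : ℝ => R (NormedSpace.exp (s • B n) (R (R y))))
          ((R - 1) (W n s - ε n • S n (W n s))) s := by
        intro s hs
        rw [Set.uIcc_of_le ht] at hs
        have h1 := R.hasFDerivAt.comp_hasDerivAt s
          ((ContinuousLinearMap.apply ℝ X (R (R y))).hasFDerivAt.comp_hasDerivAt s
            (hasDerivAt_exp_smul_const' (B n) s))
        refine h1.congr_deriv ?_
        have e1 : (R - 1) (W n s - ε n • S n (W n s)) = B n (R (W n s)) :=
          (yosidaApprox_apply hR (hε n) _).symm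
        have e2 : R (B n (W n s)) = B n (R (W n s)) :=
          congrArg (fun T : X →L[ℝ] X => T (W n s)) (commute_yosidaApprox (R := R) (ε n)).eq
        rw [e1, ← e2]
        simp [W, max_eq_left hs.1]
      have hc : Continuous fun s => (R - 1) (W n s - ε n • S n (W n s)) := by
        have := hWc n
        fun_prop
      have := intervalIntegral.integral_eq_sub_of_hasDerivAt hd (hc.intervalIntegrable _ _)
      rw [this]
      simp [W, max_eq_left ht]
    have hlim : Tendsto (fun n => ∫ s in (0 : ℝ)..t, (R - 1) (W n s - ε n • S n (W n s))) atTop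
        (𝓝 (∫ s in (0 : ℝ)..t, (R - 1) (w s))) := by
      refine intervalIntegral.tendsto_integral_filter_of_dominated_convergence
        (fun _ => 2 * (‖R (R y)‖ + ‖R y‖)) ?_ ?_ ?_ ?_
      · refine Eventually.of_forall fun n => Continuous.aestronglyMeasurable ?_
        have := hWc n
        fun_prop
      · refine Eventually.of_forall fun n => Eventually.of_forall fun s _ => ?_
        refine (norm_sub_one_apply_le hR _).trans ?_
        gcongr
        refine (norm_sub_le _ _).trans ?_
        gcongr
        · exact norm_exp_smul_apply_le_of_dissipative (hB n) (le_max_right _ _) _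
        · rw [norm_smul, Real.norm_of_nonneg (hε n).le]
          calc ε n * ‖S n (W n s)‖ ≤ 1 * ‖R y‖ :=
                mul_le_mul (hεn1 n) (hSW n s) (norm_nonneg _) zero_le_one
            _ = ‖R y‖ := one_mul _
      · exact intervalIntegrable_const
      · refine Eventually.of_forall fun s _ => ?_
        have h0 : Tendsto (fun n => ε n • S n (W n s)) atTop (𝓝 0) := by
          refine squeeze_zero_norm (a := fun n => ε n * ‖R y‖) (fun n => ?_) (by
            simpa using hε0.mul_const ‖R y‖)
          rw [norm_smul, Real.norm_of_nonneg (hε n).le]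
          exact mul_le_mul_of_nonneg_left (hSW n s) (hε n).le
        have := ((R - 1).continuous.tendsto _).comp ((hw s).sub h0)
        simpa [Function.comp_def] using this
    have hl := ((R.continuous.tendsto _).comp (hw 0)).add hlim
    refine tendsto_nhds_unique ((R.continuous.tendsto _).comp (hw t)) ?_
    refine hl.congr fun n => ?_
    exact (hn n).symm
  have hc : Continuous fun s => (R - 1) (w s) := (R - 1).continuous.comp hwc
  have hd := ((hc.integral_hasStrictDerivAt 0 t).hasDerivAt.const_add (R (w 0))).hasDerivWithinAt
    (s := Set.Ici 0)
  exact hd.congr (fun s hs => hint s hs) (hint t ht)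

end Evolution

/-! ### Strong solutions of abstract damped wave equations -/

section DampedWave

open Filter Topology
open scoped RealInnerProductSpace

variable {E F : Type*} [NormedAddCommGroup E] [InnerProductSpace ℝ E]
  [NormedAddCommGroup F] [InnerProductSpace ℝ F]

/-- `U` with velocity `Y` and acceleration `Z` is a strong solution on `[0, ∞)` of
`U'' + U + A U + B U' = 0`, tested against `E`. Here `J : E → F` is the embedding, the duality
mapping of `E` is hidden in the inner product `⟪U, φ⟫`, and the damping `B : E → E'` is read as an
operator on `E` through the Riesz representation. -/
structure IsStrongSolution (J : E →L[ℝ] F) (A : F →L[ℝ] F) (B : E →L[ℝ] E)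
    (U Y : ℝ → E) (Z : ℝ → F) : Prop where
  deriv_position : ∀ t : ℝ, 0 ≤ t → HasDerivWithinAt U (Y t) (Set.Ici 0) t
  deriv_velocity : ∀ t : ℝ, 0 ≤ t → HasDerivWithinAt (fun s => J (Y s)) (Z t) (Set.Ici 0) t
  equation : ∀ t : ℝ, 0 ≤ t → ∀ φ : E,
    ⟪Z t, J φ⟫ + ⟪U t, φ⟫ + ⟪A (J (U t)), J φ⟫ + ⟪B (Y t), φ⟫ = 0

namespace IsStrongSolution

variable {J : E →L[ℝ] F} {A : F →L[ℝ] F} {B : E →L[ℝ] E} {U Y U₁ Y₁ : ℝ → E} {Z Z₁ : ℝ → F}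

theorem sub (h : IsStrongSolution J A B U Y Z) (h₁ : IsStrongSolution J A B U₁ Y₁ Z₁) :
    IsStrongSolution J A B (U - U₁) (Y - Y₁) (Z - Z₁) where
  deriv_position t ht := (h.deriv_position t ht).sub (h₁.deriv_position t ht)
  deriv_velocity t ht := by
    simpa [Pi.sub_def] using (h.deriv_velocity t ht).sub (h₁.deriv_velocity t ht)
  equation t ht φ := by
    have e := h.equation t ht φ
    have e₁ := h₁.equation t ht φ
    simp only [Pi.sub_apply, map_sub, inner_sub_left]
    linarith

theorem hasDerivWithinAt_embedding (h : IsStrongSolution J A B U Y Z) {t : ℝ} (ht : 0 ≤ t) :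
    HasDerivWithinAt (fun s => J (U s)) (J (Y t)) (Set.Ici 0) t :=
  J.hasFDerivAt.comp_hasDerivWithinAt t (h.deriv_position t ht)

/-- The energy of a strong solution is nonincreasing; since `A` is nonnegative this bounds the
solution by its data, uniformly in time. -/
theorem energy_le (h : IsStrongSolution J A B U Y Z) (hA : ∀ x, 0 ≤ ⟪A x, x⟫)
    (hA' : ∀ x y, ⟪A x, y⟫ = ⟪x, A y⟫) (hB : ∀ x, 0 ≤ ⟪B x, x⟫) {t : ℝ} (ht : 0 ≤ t) :
    ‖U t‖ ^ 2 + ‖J (Y t)‖ ^ 2 ≤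
      (1 + ‖A‖ * ‖J‖ ^ 2) * (‖U 0‖ ^ 2 + ‖J (Y 0)‖ ^ 2) := by
  let e : ℝ → ℝ := fun s => ‖U s‖ ^ 2 + ⟪A (J (U s)), J (U s)⟫ + ‖J (Y s)‖ ^ 2
  have hd : ∀ s ∈ Set.Ici (0 : ℝ), HasDerivWithinAt e (-2 * ⟪B (Y s), Y s⟫) (Set.Ici 0) s := by
    intro s hs
    have h0 := h.hasDerivWithinAt_embedding hs
    have h1 := ((h.deriv_position s hs).norm_sq.add
      ((A.hasFDerivAt.comp_hasDerivWithinAt s h0).inner ℝ h0)).add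
      (h.deriv_velocity s hs).norm_sq
    refine h1.congr_deriv ?_
    have h2 := h.equation s hs (Y s)
    have h3 : ⟪J (Y s), Z s⟫ = ⟪Z s, J (Y s)⟫ := real_inner_comm _ _
    have h4 : ⟪A (J (Y s)), J (U s)⟫ = ⟪A (J (U s)), J (Y s)⟫ := by
      rw [hA', real_inner_comm]
    simp only [Function.comp_apply, h3, h4]
    linarith
  have hanti : AntitoneOn e (Set.Ici 0) := by
    refine antitoneOn_of_hasDerivWithinAt_nonpos (convex_Ici 0)
      (fun s hs => (hd s hs).continuousWithinAt)
      (fun s hs => (hd s (interior_subset hs)).mono interior_subset) fun s _ => ?_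
    linarith [hB (Y s)]
  have h1 := hanti (Set.mem_Ici.2 le_rfl) (Set.mem_Ici.2 ht) ht
  have h2 : ⟪A (J (U 0)), J (U 0)⟫ ≤ ‖A‖ * ‖J‖ ^ 2 * ‖U 0‖ ^ 2 := by
    calc ⟪A (J (U 0)), J (U 0)⟫ ≤ ‖A (J (U 0))‖ * ‖J (U 0)‖ := real_inner_le_norm _ _
      _ ≤ (‖A‖ * (‖J‖ * ‖U 0‖)) * (‖J‖ * ‖U 0‖) := by
        gcongr
        · exact A.le_opNorm_of_le (J.le_opNorm _)
        · exact J.le_opNorm _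
      _ = _ := by ring
  have h3 : 0 ≤ ‖A‖ * ‖J‖ ^ 2 * ‖J (Y 0)‖ ^ 2 := by positivity
  have h4 := hA (J (U t))
  simp only [e] at h1
  nlinarith

end IsStrongSolution

variable [CompleteSpace E] [CompleteSpace F]

open ContinuousLinearMap in
/-- The resolvent equation of the damped wave operator, solved by Lax–Milgram: `G z` is the
position, and `μ G z - z₁` the velocity. -/
theorem exists_resolvent (J : E →L[ℝ] F) (A : F →L[ℝ] F) (B : E →L[ℝ] E)
    (hA : ∀ x, 0 ≤ ⟪A x, x⟫) (hB : ∀ x, 0 ≤ ⟪B x, x⟫) {μ : ℝ} (hμ : 0 ≤ μ) :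
    ∃ G : WithLp 2 (E × F) →L[ℝ] E, ∀ z φ,
      ⟪μ • J (μ • G z - z.fst) - z.snd, J φ⟫ + ⟪G z, φ⟫ + ⟪A (J (G z)), J φ⟫
        + ⟪B (μ • G z - z.fst), φ⟫ = 0 := by
  let Q : E →L[ℝ] E :=
    (μ ^ 2) • (adjoint J ∘L J) + 1 + adjoint J ∘L A ∘L J + μ • B
  have hQin : ∀ u φ, ⟪Q u, φ⟫ =
      μ ^ 2 * ⟪J u, J φ⟫ + ⟪u, φ⟫ + ⟪A (J u), J φ⟫ + μ * ⟪B u, φ⟫ := by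
    intro u φ
    simp [Q, inner_add_left, inner_smul_left, adjoint_inner_left]
  have hQ : IsUnit Q := by
    refine isUnit_of_forall_le_norm_inner_map Q (c := 1) one_pos fun x => ?_
    rw [hQin, Real.norm_eq_abs]
    refine le_trans ?_ (le_abs_self _)
    have h1 := hA (J x)
    have h2 := mul_nonneg hμ (hB x)
    rw [real_inner_self_eq_norm_sq, real_inner_self_eq_norm_sq]
    have h3 : 0 ≤ μ ^ 2 * ‖J x‖ ^ 2 := by positivity
    simp only [NNReal.coe_one, mul_one]
    linarith
  let f : WithLp 2 (E × F) →L[ℝ] E := WithLp.fstL 2 ℝ E F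
  let s : WithLp 2 (E × F) →L[ℝ] F := WithLp.sndL 2 ℝ E F
  let P : WithLp 2 (E × F) →L[ℝ] E :=
    adjoint J ∘L s + μ • (adjoint J ∘L J ∘L f) + B ∘L f
  refine ⟨Ring.inverse Q ∘L P, fun z φ => ?_⟩
  set u := (Ring.inverse Q ∘L P) z with hu
  have h1 : Q u = P z :=
    congrArg (fun T : E →L[ℝ] E => T (P z)) (Ring.mul_inverse_cancel Q hQ)
  have h2 := hQin u φ
  rw [h1] at h2
  have h3 : ⟪P z, φ⟫ = ⟪z.snd, J φ⟫ + μ * ⟪J z.fst, J φ⟫ + ⟪B z.fst, φ⟫ := by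
    simp [P, f, s, inner_add_left, inner_smul_left, adjoint_inner_left]
  simp only [map_sub, map_smul, inner_sub_left, inner_smul_left, smul_sub, conj_trivial]
  linarith

/-- Strong solutions exist for a dense set of data: the resolvent of the shifted wave operator is
firmly nonexpansive in `E × F`, and trajectories start in the range of its cube. -/
theorem exists_isStrongSolution_near {J : E →L[ℝ] F} (hJ : Function.Injective J)
    (hJ' : DenseRange J) {A : F →L[ℝ] F} {B : E →L[ℝ] E}
    (hA : ∀ x, 0 ≤ ⟪A x, x⟫) (hB : ∀ x, 0 ≤ ⟪B x, x⟫) (u : E) (v : F) {ε : ℝ} (hε : 0 < ε) :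
    ∃ U Y Z, IsStrongSolution J A B U Y Z ∧ ‖U 0 - u‖ < ε ∧ ‖J (Y 0) - v‖ < ε := by
  set k : ℝ := ‖A‖ * ‖J‖ with hk
  have hk0 : 0 ≤ k := by positivity
  -- the shift `k` compensates for the position norm not containing `A`
  set μ : ℝ := 1 + k with hμ
  obtain ⟨G, hG⟩ := exists_resolvent J A B hA hB (μ := μ) (by linarith)
  let f : WithLp 2 (E × F) →L[ℝ] E := WithLp.fstL 2 ℝ E F
  let s : WithLp 2 (E × F) →L[ℝ] F := WithLp.sndL 2 ℝ E F
  let R : WithLp 2 (E × F) →L[ℝ] WithLp 2 (E × F) :=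
    (WithLp.prodContinuousLinearEquiv 2 ℝ E F).symm.toContinuousLinearMap ∘L
      (G.prod (J ∘L (μ • G - f)))
  have hRf : ∀ z, (R z).fst = G z := fun z => rfl
  have hRs : ∀ z, (R z).snd = J (μ • G z - z.fst) := fun z => rfl
  have hR : ∀ z, ‖R z‖ ^ 2 ≤ ⟪R z, z⟫ := by
    intro z
    set y := μ • G z - z.fst with hy
    have hz : z.fst = μ • G z - y := by rw [hy]; abel
    have e := hG z y
    rw [← hy] at e
    have hn : ‖R z‖ ^ 2 = ‖G z‖ ^ 2 + ‖J y‖ ^ 2 := by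
      rw [WithLp.prod_norm_sq_eq_of_L2]
      simp only [hRf, hRs, hy]
    have hi : ⟪R z, z⟫ = ⟪G z, z.fst⟫ + ⟪J y, z.snd⟫ := rfl
    have hc : ⟪J y, z.snd⟫ = ⟪z.snd, J y⟫ := real_inner_comm _ _
    have hAe : |⟪A (J (G z)), J y⟫| ≤ k * ‖G z‖ * ‖J y‖ := by
      refine (abs_real_inner_le_norm _ _).trans ?_
      gcongr
      rw [hk, mul_assoc]
      exact A.le_opNorm_of_le (J.le_opNorm _)
    have hAl := (abs_le.1 hAe).1
    rw [hn, hi, hz, hc]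
    simp only [inner_sub_left, inner_sub_right, inner_smul_left, inner_smul_right,
      real_inner_self_eq_norm_sq, conj_trivial] at e ⊢
    have hBy := hB y
    have hq : k * ‖G z‖ * ‖J y‖ ≤ k * (‖G z‖ ^ 2 + ‖J y‖ ^ 2) := by
      rw [mul_assoc]
      refine mul_le_mul_of_nonneg_left ?_ hk0
      nlinarith [sq_nonneg (‖G z‖ - ‖J y‖), sq_nonneg ‖G z‖, sq_nonneg ‖J y‖]
    have hexp : μ * ‖G z‖ ^ 2 + μ * ‖J y‖ ^ 2 =
        ‖G z‖ ^ 2 + ‖J y‖ ^ 2 + k * (‖G z‖ ^ 2 + ‖J y‖ ^ 2) := by rw [hμ]; ring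
    linarith
  have hRinj : ∀ z, R z = 0 → z = 0 := by
    intro z hz
    have h1 : G z = 0 := by rw [← hRf, hz]; rfl
    have h2 : J (μ • G z - z.fst) = 0 := by rw [← hRs, hz]; rfl
    have h3 : μ • G z - z.fst = 0 := hJ (by rw [h2, map_zero])
    have h4 : z.fst = 0 := by simpa [h1] using h3
    have h5 : z.snd = 0 := by
      refine hJ'.eq_zero_of_inner_left ℝ fun φ => ?_
      have e := hG z φ
      rw [h3, h1] at e
      simpa [inner_neg_left] using e
    exact (WithLp.ofLp_injective 2) (Prod.ext h4 h5)
  -- a vector orthogonal to the range satisfies `⟪R z, z⟫ = 0`, hence `R z = 0`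
  have hRdense : DenseRange R := by
    have : (LinearMap.range (R : WithLp 2 (E × F) →ₗ[ℝ] WithLp 2 (E × F))).topologicalClosure
        = ⊤ := by
      rw [Submodule.topologicalClosure_eq_top_iff, Submodule.eq_bot_iff]
      intro z hz
      have h1 : ⟪R z, z⟫ = 0 := (Submodule.mem_orthogonal _ _).1 hz (R z) ⟨z, rfl⟩
      have h2 := hR z
      rw [h1] at h2
      exact hRinj z (norm_eq_zero.1 (pow_eq_zero_iff two_ne_zero |>.1
        (le_antisymm h2 (sq_nonneg _))))
    have h2 := Submodule.dense_iff_topologicalClosure_eq_top.2 this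
    simpa only [DenseRange, LinearMap.coe_range, ContinuousLinearMap.coe_coe] using h2
  have hR3 : DenseRange (fun z => R (R (R z))) :=
    hRdense.comp (hRdense.comp hRdense R.continuous) R.continuous
  obtain ⟨y₀, hy₀⟩ := hR3.exists_dist_lt (WithLp.toLp 2 (u, v)) hε
  obtain ⟨w, -, hw0, hw⟩ := exists_trajectory hR y₀
  have hexp : ∀ t : ℝ, HasDerivWithinAt (fun t : ℝ => Real.exp (k * t)) (Real.exp (k * t) * k)
      (Set.Ici 0) t := fun t => by
    have := ((hasDerivAt_id t).const_mul k).exp.hasDerivWithinAt (s := Set.Ici 0)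
    simpa using this
  -- undo the shift of the generator: multiply the contracting trajectory by `exp (k t)`
  refine ⟨fun t => Real.exp (k * t) • G (w t),
    fun t => Real.exp (k * t) • (μ • G (w t) - (w t).fst),
    fun t => Real.exp (k * t) • (μ • J (μ • G (w t) - (w t).fst) - (w t).snd), ⟨?_, ?_, ?_⟩, ?_⟩
  · intro t ht
    have h1 := (hexp t).smul (f.hasFDerivAt.comp_hasDerivWithinAt t (hw t ht))
    refine h1.congr_deriv ?_
    change _ • (G (w t) - (w t).fst) + _ • G (w t) = _
    rw [hμ]
    module
  · intro t ht
    have h1 := (hexp t).smul (s.hasFDerivAt.comp_hasDerivWithinAt t (hw t ht))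
    have h2 : (fun t => J (Real.exp (k * t) • (μ • G (w t) - (w t).fst))) =
        fun t => Real.exp (k * t) • s (R (w t)) := by
      funext t
      rw [map_smul]
      rfl
    rw [h2]
    refine h1.congr_deriv ?_
    change _ • (J (μ • G (w t) - (w t).fst) - (w t).snd) + _ • J (μ • G (w t) - (w t).fst) = _
    generalize J (μ • G (w t) - (w t).fst) = a
    rw [hμ]
    module
  · intro t _ φ
    have e := hG (w t) φ
    simp only [map_smul, inner_smul_left, conj_trivial]
    rw [← mul_add, ← mul_add, ← mul_add, e, mul_zero]
  · rw [dist_comm, dist_eq_norm] at hy₀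
    have h1 : ‖(R (R (R y₀)) - WithLp.toLp 2 (u, v)).fst‖ < ε :=
      (WithLp.norm_fst_le _ _).trans_lt hy₀
    have h2 : ‖(R (R (R y₀)) - WithLp.toLp 2 (u, v)).snd‖ < ε :=
      (WithLp.norm_snd_le _ _).trans_lt hy₀
    rw [← hw0] at h1 h2
    simp only [mul_zero, Real.exp_zero, one_smul]
    exact ⟨h1, h2⟩

end DampedWave

/-! ### Undamped projections cannot decay -/

section Projection

open Filter Topology
open scoped RealInnerProductSpace

/-- A pigeonhole form of the Arzelà–Ascoli theorem. -/
theorem exists_ne_forall_norm_sub_le {E G : Type*} [NormedAddCommGroup E] [NormedSpace ℝ E]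
    [NormedAddCommGroup G] [NormedSpace ℝ G] {Φ : E →L[ℝ] G} (hΦ : IsCompactOperator Φ)
    {U : ℕ → ℝ → E} {K K' T η : ℝ} (hK : ∀ n t, 0 ≤ t → ‖U n t‖ ≤ K) (hK' : 0 ≤ K')
    (hlip : ∀ n s t, 0 ≤ s → 0 ≤ t → ‖Φ (U n s) - Φ (U n t)‖ ≤ K' * |s - t|) (hη : 0 < η) :
    ∃ n m, n ≠ m ∧ ∀ t ∈ Set.Icc 0 T, ‖Φ (U n t) - Φ (U m t)‖ ≤ η := by
  set δ := η / (4 * (K' + 1)) with hδ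
  have hδ0 : 0 < δ := by positivity
  have hδK : K' * δ ≤ η / 4 := by
    have : (K' + 1) * δ = η / 4 := by rw [hδ]; field_simp
    nlinarith
  obtain ⟨S, hST, hSf, hS⟩ := (isCompact_Icc (a := (0 : ℝ)) (b := T)).finite_cover_balls hδ0
  have : Fintype S := hSf.fintype
  obtain ⟨C, hC, hUC⟩ := IsCompactOperator.image_closedBall_subset_compact (f := (Φ : E →ₗ[ℝ] G))
    hΦ K
  have hmem : ∀ n, (fun s : S => Φ (U n s)) ∈ Set.univ.pi fun _ : S => C := fun n s _ =>
    hUC ⟨U n s, by simpa using hK n s (hST s.2).1, rfl⟩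
  obtain ⟨a, -, ψ, hψ, ha⟩ := (isCompact_univ_pi fun _ : S => hC).tendsto_subseq hmem
  obtain ⟨n₀, hn₀⟩ := Metric.cauchySeq_iff.1 ha.cauchySeq (η / 2) (by positivity)
  refine ⟨ψ n₀, ψ (n₀ + 1), (hψ (Nat.lt_succ_self n₀)).ne, fun t ht => ?_⟩
  obtain ⟨s, hs, hts⟩ := Set.mem_iUnion₂.1 (hS ht)
  have hst : |t - s| ≤ δ := by
    rw [← Real.dist_eq]
    exact (Metric.mem_ball.1 hts).le
  have h1 : ‖Φ (U (ψ n₀) s) - Φ (U (ψ (n₀ + 1)) s)‖ ≤ η / 2 := by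
    rw [← dist_eq_norm]
    exact ((dist_le_pi_dist _ _ (⟨s, hs⟩ : S)).trans_lt
      (hn₀ n₀ le_rfl (n₀ + 1) (Nat.le_succ _))).le
  have h2 : ∀ n, ‖Φ (U n t) - Φ (U n s)‖ ≤ η / 4 := fun n =>
    ((hlip n t s ht.1 (hST hs).1).trans (mul_le_mul_of_nonneg_left hst hK')).trans hδK
  have e : Φ (U (ψ n₀) t) - Φ (U (ψ (n₀ + 1)) t) =
      (Φ (U (ψ n₀) t) - Φ (U (ψ n₀) s)) + (Φ (U (ψ n₀) s) - Φ (U (ψ (n₀ + 1)) s))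
        - (Φ (U (ψ (n₀ + 1)) t) - Φ (U (ψ (n₀ + 1)) s)) := by abel
  rw [e]
  refine (norm_sub_le _ _).trans ?_
  linarith [norm_add_le (Φ (U (ψ n₀) t) - Φ (U (ψ n₀) s))
    (Φ (U (ψ n₀) s) - Φ (U (ψ (n₀ + 1)) s)), h2 (ψ n₀), h2 (ψ (n₀ + 1))]

variable {V H E F : Type*} [NormedAddCommGroup V] [InnerProductSpace ℝ V]
  [NormedAddCommGroup H] [InnerProductSpace ℝ H]
  [NormedAddCommGroup E] [InnerProductSpace ℝ E]
  [NormedAddCommGroup F] [InnerProductSpace ℝ F]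

/-- A compatible pair of projections `P : E → V` and `Q : F → H` of the energy space which is not
affected by the damping `B`; the adjoint of `P` is given as `P'`. -/
structure IsUndampedProjection (ι : V →L[ℝ] H) (J : E →L[ℝ] F) (B : E →L[ℝ] E)
    (P : E →L[ℝ] V) (Q : F →L[ℝ] H) (P' : V → E) : Prop where
  embedding : ∀ u, ι (P u) = Q (J u)
  inner_adjoint : ∀ u φ, ⟪u, P' φ⟫ = ⟪P u, φ⟫
  inner_embedding_adjoint : ∀ z φ, ⟪z, J (P' φ)⟫ = ⟪Q z, ι φ⟫
  inner_damping : ∀ y φ, ⟪B y, P' φ⟫ = 0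

variable {ι : V →L[ℝ] H} {J : E →L[ℝ] F} {A : F →L[ℝ] F} {B : E →L[ℝ] E}
  {P : E →L[ℝ] V} {Q : F →L[ℝ] H} {P' : V → E}

/-- The energy of the projected solution changes only through the coupling `Q A J`. -/
theorem IsUndampedProjection.energy_sub_le (hP : IsUndampedProjection ι J B P Q P')
    {U Y : ℝ → E} {Z : ℝ → F} (h : IsStrongSolution J A B U Y Z) {T η K : ℝ} (hT : 0 ≤ T)
    (hη : ∀ t ∈ Set.Icc 0 T, ‖Q (A (J (U t)))‖ ≤ η)
    (hK : ∀ t ∈ Set.Icc 0 T, ‖Q (J (Y t))‖ ≤ K) :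
    ‖P (U 0)‖ ^ 2 + ‖Q (J (Y 0))‖ ^ 2 - 2 * (η * K) * T ≤
      ‖P (U T)‖ ^ 2 + ‖Q (J (Y T))‖ ^ 2 := by
  let e : ℝ → ℝ := fun s => ‖P (U s)‖ ^ 2 + ‖Q (J (Y s))‖ ^ 2
  have hd : ∀ s ∈ Set.Icc 0 T,
      HasDerivWithinAt e (-2 * ⟪Q (A (J (U s))), Q (J (Y s))⟫) (Set.Icc 0 T) s := by
    intro s hs
    have h1 := ((P.hasFDerivAt.comp_hasDerivWithinAt s (h.deriv_position s hs.1)).norm_sq.add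
      (Q.hasFDerivAt.comp_hasDerivWithinAt s (h.deriv_velocity s hs.1)).norm_sq).mono
        (fun x hx => hx.1 : Set.Icc 0 T ⊆ Set.Ici 0)
    refine h1.congr_deriv ?_
    -- the projected velocity is itself an admissible test vector
    have h2 := h.equation s hs.1 (P' (P (Y s)))
    rw [hP.inner_embedding_adjoint, hP.inner_embedding_adjoint, hP.inner_adjoint,
      hP.inner_damping, hP.embedding] at h2
    have h3 : ⟪Q (J (Y s)), Q (Z s)⟫ = ⟪Q (Z s), Q (J (Y s))⟫ := real_inner_comm _ _
    simp only [Function.comp_apply, h3]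
    linarith
  have hb : ∀ s ∈ Set.Icc 0 T, ‖-2 * ⟪Q (A (J (U s))), Q (J (Y s))⟫‖ ≤ 2 * (η * K) := by
    intro s hs
    rw [norm_mul]
    norm_num
    refine (abs_real_inner_le_norm _ _).trans ?_
    exact mul_le_mul (hη s hs) (hK s hs) (norm_nonneg _) ((norm_nonneg _).trans (hη s hs))
  have h1 := (convex_Icc 0 T).norm_image_sub_le_of_norm_hasDerivWithin_le hd hb
    (Set.left_mem_Icc.2 hT) (Set.right_mem_Icc.2 hT)
  rw [sub_zero, Real.norm_of_nonneg hT] at h1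
  have h2 := (abs_le.1 h1).1
  simp only [e] at h2
  linarith

/-- If the coupling is compact, an undamped projection of an infinite-dimensional system does not
decay uniformly exponentially: among infinitely many separated data, two solutions have almost the
same coupling term on `[0, T]`, so the projection of their difference almost conserves energy. -/
theorem IsUndampedProjection.not_uniform_decay [CompleteSpace E] [CompleteSpace F]
    (hP : IsUndampedProjection ι J B P Q P') (hV : ¬ FiniteDimensional ℝ V)
    (hJ : Function.Injective J) (hJ' : DenseRange J)
    (hA : ∀ x, 0 ≤ ⟪A x, x⟫) (hA' : ∀ x y, ⟪A x, y⟫ = ⟪x, A y⟫) (hB : ∀ x, 0 ≤ ⟪B x, x⟫)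
    (hcompact : IsCompactOperator (Q ∘L A ∘L J)) {S : V →L[ℝ] E} (hS : ∀ v, P (S v) = v)
    {C ω : ℝ} (hω : 0 < ω) (hdecay : ∀ U Y Z, IsStrongSolution J A B U Y Z → ∀ t : ℝ, 0 ≤ t →
      ‖P (U t)‖ ^ 2 + ‖Q (J (Y t))‖ ^ 2 ≤
        C * Real.exp (-ω * t) * (‖U 0‖ ^ 2 + ‖J (Y 0)‖ ^ 2)) : False := by
  obtain ⟨r, v, hr, hvr, hv⟩ := exists_seq_norm_le_one_le_norm_sub hV
  set δ : ℝ := 1 / (4 * (‖P‖ + 1)) with hδ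
  have hδ0 : 0 < δ := by positivity
  have hPδ : ‖P‖ * δ ≤ 1 / 4 := by
    have : (‖P‖ + 1) * δ = 1 / 4 := by rw [hδ]; field_simp
    nlinarith
  have hδ1 : δ ≤ 1 := by
    rw [hδ, div_le_one (by positivity)]
    linarith [norm_nonneg P]
  choose U Y Z hsol hU0 hY0 using fun n =>
    exists_isStrongSolution_near hJ hJ' hA hB (S (v n)) 0 hδ0
  set K : ℝ := Real.sqrt ((1 + ‖A‖ * ‖J‖ ^ 2) * ((‖S‖ * r + 1) ^ 2 + 1 ^ 2)) with hK
  have hK0 : 0 ≤ K := Real.sqrt_nonneg _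
  have hbound : ∀ n t, 0 ≤ t → ‖U n t‖ ^ 2 + ‖J (Y n t)‖ ^ 2 ≤ K ^ 2 := by
    intro n t ht
    rw [hK, Real.sq_sqrt (by positivity)]
    refine ((hsol n).energy_le hA hA' hB ht).trans ?_
    have h1 : ‖U n 0‖ ≤ ‖S‖ * r + 1 := by
      have := norm_le_norm_add_norm_sub (S (v n)) (U n 0)
      rw [norm_sub_rev] at this
      have h2 := S.le_opNorm_of_le (hvr n)
      linarith [(hU0 n).le]
    have h2 : ‖J (Y n 0)‖ ≤ 1 := by
      have := hY0 n
      rw [sub_zero] at this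
      linarith
    gcongr
  have hUK : ∀ n t, 0 ≤ t → ‖U n t‖ ≤ K := fun n t ht =>
    abs_le_of_sq_le_sq' (by linarith [hbound n t ht, sq_nonneg ‖J (Y n t)‖]) hK0 |>.2
  have hYK : ∀ n t, 0 ≤ t → ‖J (Y n t)‖ ≤ K := fun n t ht =>
    abs_le_of_sq_le_sq' (by linarith [hbound n t ht, sq_nonneg ‖U n t‖]) hK0 |>.2
  have hlip : ∀ n s t, 0 ≤ s → 0 ≤ t →
      ‖(Q ∘L A ∘L J) (U n s) - (Q ∘L A ∘L J) (U n t)‖ ≤ ‖Q ∘L A‖ * K * |s - t| := by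
    intro n s t hs ht
    exact (convex_Ici (0 : ℝ)).norm_image_sub_le_of_norm_hasDerivWithin_le
      (f := fun s => (Q ∘L A) (J (U n s)))
      (fun s hs => (Q ∘L A).hasFDerivAt.comp_hasDerivWithinAt s
        ((hsol n).hasDerivWithinAt_embedding hs))
      (fun s hs => (Q ∘L A).le_opNorm_of_le (hYK n s hs)) ht hs
  -- the time at which the decay estimate contradicts almost conservation
  obtain ⟨T, hT0, hT⟩ : ∃ T : ℝ, 0 ≤ T ∧ C * Real.exp (-ω * T) * (8 * K ^ 2) < 1 / 16 := by
    have h1 : Tendsto (fun T : ℝ => C * Real.exp (-ω * T) * (8 * K ^ 2)) atTop (𝓝 0) := by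
      have h2 : Tendsto (fun T : ℝ => Real.exp (-ω * T)) atTop (𝓝 0) :=
        Real.tendsto_exp_atBot.comp (tendsto_id.const_mul_atTop_of_neg (neg_lt_zero.2 hω))
      simpa using (h2.const_mul C).mul_const (8 * K ^ 2)
    exact ((eventually_ge_atTop 0).and (h1.eventually (gt_mem_nhds (by norm_num)))).exists
  set η : ℝ := 1 / (64 * (‖Q‖ * K * T + 1)) with hη
  have hη0 : 0 < η := by positivity
  have hηT : 2 * (η * (2 * (‖Q‖ * K))) * T ≤ 1 / 16 := by
    have : (‖Q‖ * K * T + 1) * η = 1 / 64 := by rw [hη]; field_simp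
    nlinarith
  -- two solutions with almost equal coupling terms on `[0, T]`, and their difference
  obtain ⟨n, m, hnm, hclose⟩ := exists_ne_forall_norm_sub_le (T := T) hcompact hUK
    (by positivity) hlip hη0
  have hW := (hsol n).sub (hsol m)
  have hlow := hP.energy_sub_le hW hT0 (η := η) (K := 2 * (‖Q‖ * K))
    (fun t ht => by simpa using hclose t ht)
    (fun t ht => by
      have h1 := Q.le_opNorm_of_le (hYK n t ht.1)
      have h2 := Q.le_opNorm_of_le (hYK m t ht.1)
      simp only [Pi.sub_apply, map_sub]
      linarith [norm_sub_le (Q (J (Y n t))) (Q (J (Y m t)))])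
  have hup := hdecay _ _ _ hW T hT0
  have hP0 : 1 / 2 ≤ ‖P ((U n - U m) 0)‖ := by
    have h1 : ∀ k, ‖P (U k 0) - v k‖ ≤ 1 / 4 := fun k => by
      conv_lhs => rw [← hS (v k), ← map_sub]
      exact (P.le_opNorm_of_le (hU0 k).le).trans hPδ
    have e : v n - v m = P ((U n - U m) 0) - (P (U n 0) - v n) + (P (U m 0) - v m) := by
      simp only [Pi.sub_apply, map_sub]
      abel
    have h2 : 1 ≤ ‖v n - v m‖ := hv hnm
    rw [e] at h2
    have h3 := norm_add_le (P ((U n - U m) 0) - (P (U n 0) - v n)) (P (U m 0) - v m)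
    have h4 := norm_sub_le (P ((U n - U m) 0)) (P (U n 0) - v n)
    linarith [h1 n, h1 m]
  have hdata : ‖(U n - U m) 0‖ ^ 2 + ‖J ((Y n - Y m) 0)‖ ^ 2 ≤ 8 * K ^ 2 := by
    have h1 : ‖(U n - U m) 0‖ ≤ 2 * K := by
      have := norm_sub_le (U n 0) (U m 0)
      simp only [Pi.sub_apply]
      linarith [hUK n 0 le_rfl, hUK m 0 le_rfl]
    have h2 : ‖J ((Y n - Y m) 0)‖ ≤ 2 * K := by
      have := norm_sub_le (J (Y n 0)) (J (Y m 0))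
      simp only [Pi.sub_apply, map_sub]
      linarith [hYK n 0 le_rfl, hYK m 0 le_rfl]
    nlinarith [norm_nonneg ((U n - U m) 0), norm_nonneg (J ((Y n - Y m) 0))]
  have hC : 0 ≤ C * Real.exp (-ω * T) ∨ C * Real.exp (-ω * T) < 0 := le_or_gt _ _
  rcases hC with hC | hC
  · have := mul_le_mul_of_nonneg_left hdata hC
    nlinarith [sq_nonneg ‖Q (J ((Y n - Y m) 0))‖]
  · have : C * Real.exp (-ω * T) * (‖(U n - U m) 0‖ ^ 2 + ‖J ((Y n - Y m) 0)‖ ^ 2) ≤ 0 :=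
      mul_nonpos_of_nonpos_of_nonneg hC.le (by positivity)
    nlinarith [sq_nonneg ‖Q (J ((Y n - Y m) 0))‖]

end Projection

/-! ### Matrices acting on product Hilbert spaces -/

section Componentwise

open scoped RealInnerProductSpace

variable {G G' : Type*} [NormedAddCommGroup G] [InnerProductSpace ℝ G]
  [NormedAddCommGroup G'] [InnerProductSpace ℝ G'] {N : ℕ}

/-- The componentwise action of a bounded operator on the Hilbert space `G^N`. -/
noncomputable def diagOp (N : ℕ) (T : G →L[ℝ] G') :
    PiLp 2 (fun _ : Fin N => G) →L[ℝ] PiLp 2 (fun _ : Fin N => G') :=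
  (PiLp.continuousLinearEquiv 2 ℝ fun _ : Fin N => G').symm.toContinuousLinearMap ∘L
    ContinuousLinearMap.pi fun i => T ∘L PiLp.proj 2 (fun _ : Fin N => G) i

/-- The linear combination `u ↦ ∑ⱼ cⱼ uⱼ` as an operator `G^N → G`. -/
noncomputable def rowOp (G : Type*) [NormedAddCommGroup G] [InnerProductSpace ℝ G]
    (c : Fin N → ℝ) : PiLp 2 (fun _ : Fin N => G) →L[ℝ] G :=
  ∑ j, c j • PiLp.proj 2 (fun _ : Fin N => G) j

/-- The action of a real square matrix on the Hilbert space `G^N`. -/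
noncomputable def matOp (G : Type*) [NormedAddCommGroup G] [InnerProductSpace ℝ G]
    (M : Matrix (Fin N) (Fin N) ℝ) :
    PiLp 2 (fun _ : Fin N => G) →L[ℝ] PiLp 2 (fun _ : Fin N => G) :=
  (PiLp.continuousLinearEquiv 2 ℝ fun _ : Fin N => G).symm.toContinuousLinearMap ∘L
    ContinuousLinearMap.pi fun i => rowOp G (M i)

/-- The operator `v ↦ (c₁ v, …, c_N v)`, adjoint to `rowOp`. -/
noncomputable def colOp (G : Type*) [NormedAddCommGroup G] [InnerProductSpace ℝ G]
    (c : Fin N → ℝ) : G →L[ℝ] PiLp 2 (fun _ : Fin N => G) :=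
  (PiLp.continuousLinearEquiv 2 ℝ fun _ : Fin N => G).symm.toContinuousLinearMap ∘L
    ContinuousLinearMap.pi fun i => c i • ContinuousLinearMap.id ℝ G

@[simp]
theorem diagOp_apply (T : G →L[ℝ] G') (u : PiLp 2 fun _ : Fin N => G) (i : Fin N) :
    diagOp N T u i = T (u i) := rfl

@[simp]
theorem rowOp_apply (c : Fin N → ℝ) (u : PiLp 2 fun _ : Fin N => G) :
    rowOp G c u = ∑ j, c j • u j := by
  simp [rowOp]

@[simp]
theorem matOp_apply (M : Matrix (Fin N) (Fin N) ℝ) (u : PiLp 2 fun _ : Fin N => G) (i : Fin N) :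
    matOp G M u i = ∑ j, M i j • u j :=
  rowOp_apply _ _

@[simp]
theorem colOp_apply (c : Fin N → ℝ) (v : G) (i : Fin N) : colOp G c v i = c i • v := rfl

theorem diagOp_injective {T : G →L[ℝ] G'} (hT : Function.Injective T) :
    Function.Injective (diagOp N T) := fun u v h => by
  ext i
  exact hT (by simpa using congrArg (fun w => w.ofLp i) h)

theorem denseRange_diagOp {T : G →L[ℝ] G'} (hT : DenseRange T) : DenseRange (diagOp N T) := by
  have h1 : DenseRange (Pi.map fun _ : Fin N => (T : G → G')) := DenseRange.piMap fun _ => hT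
  have h2 := ((PiLp.continuousLinearEquiv 2 ℝ fun _ : Fin N => G').symm.surjective.denseRange).comp
    h1 (PiLp.continuousLinearEquiv 2 ℝ fun _ : Fin N => G').symm.continuous
  refine h2.mono ?_
  rintro _ ⟨x, rfl⟩
  exact ⟨WithLp.toLp 2 x, rfl⟩

open scoped MatrixOrder in
/-- The tensor product of two positive semidefinite forms is positive semidefinite. -/
theorem Matrix.PosSemidef.sum_mul_bilin_nonneg {M : Matrix (Fin N) (Fin N) ℝ} (hM : M.PosSemidef)
    {b : G →ₗ[ℝ] G →ₗ[ℝ] ℝ} (hb : ∀ u, 0 ≤ b u u) (u : Fin N → G) :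
    0 ≤ ∑ i, ∑ j, M i j * b (u j) (u i) := by
  obtain ⟨R, hR⟩ := CStarAlgebra.nonneg_iff_eq_star_mul_self.1 hM.nonneg
  rw [Matrix.star_eq_conjTranspose] at hR
  subst hR
  have h : ∑ i, ∑ j, (R.conjTranspose * R) i j * b (u j) (u i) =
      ∑ k, b (∑ j, R k j • u j) (∑ i, R k i • u i) := by
    simp only [map_sum, map_smul, LinearMap.sum_apply, LinearMap.smul_apply, Matrix.mul_apply,
      Matrix.conjTranspose_apply, star_trivial, Finset.sum_mul, Finset.mul_sum, smul_eq_mul]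
    rw [Finset.sum_congr rfl fun i _ => Finset.sum_comm, Finset.sum_comm]
    refine Finset.sum_congr rfl fun k _ => Finset.sum_congr rfl fun i _ =>
      Finset.sum_congr rfl fun j _ => by ring
  rw [h]
  exact Finset.sum_nonneg fun k _ => hb _

theorem matOp_inner_nonneg {M : Matrix (Fin N) (Fin N) ℝ} (hM : M.PosSemidef)
    {T : G →L[ℝ] G} (hT : ∀ x, 0 ≤ ⟪T x, x⟫) (u : PiLp 2 fun _ : Fin N => G) :
    0 ≤ ⟪matOp G M (diagOp N T u), u⟫ := by
  have h := hM.sum_mul_bilin_nonneg (b := innerₗ G ∘ₗ (T : G →ₗ[ℝ] G)) (fun x => hT x) u.ofLp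
  refine h.trans_eq ?_
  simp [PiLp.inner_apply, sum_inner, inner_smul_left]

theorem matOp_inner_symm {M : Matrix (Fin N) (Fin N) ℝ} (hM : M.IsHermitian)
    (x y : PiLp 2 fun _ : Fin N => G) : ⟪matOp G M x, y⟫ = ⟪x, matOp G M y⟫ := by
  simp only [PiLp.inner_apply, matOp_apply, sum_inner, inner_sum, inner_smul_left,
    inner_smul_right, conj_trivial]
  rw [Finset.sum_comm]
  refine Finset.sum_congr rfl fun i _ => Finset.sum_congr rfl fun j _ => ?_
  rw [← hM.apply i j, star_trivial]

theorem inner_colOp (c : Fin N → ℝ) (u : PiLp 2 fun _ : Fin N => G) (φ : G) :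
    ⟪u, colOp G c φ⟫ = ⟪rowOp G c u, φ⟫ := by
  simp [PiLp.inner_apply, sum_inner, inner_smul_left, inner_smul_right]

theorem diagOp_colOp (c : Fin N → ℝ) (T : G →L[ℝ] G') (φ : G) :
    diagOp N T (colOp G c φ) = colOp G' c (T φ) := by
  ext i
  simp

theorem rowOp_matOp (c : Fin N → ℝ) (M : Matrix (Fin N) (Fin N) ℝ)
    (u : PiLp 2 fun _ : Fin N => G) :
    rowOp G c (matOp G M u) = rowOp G (Matrix.vecMul c M) u := by
  simp only [rowOp_apply, matOp_apply, Matrix.vecMul, dotProduct, Finset.smul_sum,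
    Finset.sum_smul, smul_smul]
  exact Finset.sum_comm

theorem rowOp_diagOp (c : Fin N → ℝ) (T : G →L[ℝ] G') (u : PiLp 2 fun _ : Fin N => G) :
    rowOp G' c (diagOp N T u) = T (rowOp G c u) := by
  simp

theorem isCompactOperator_rowOp_matOp_diagOp (c : Fin N → ℝ) (M : Matrix (Fin N) (Fin N) ℝ)
    {T : G →L[ℝ] G'} (hT : IsCompactOperator T) :
    IsCompactOperator (rowOp G' c ∘L matOp G' M ∘L diagOp N T) := by
  have h : rowOp G' c ∘L matOp G' M ∘L diagOp N T = T ∘L rowOp G (Matrix.vecMul c M) := by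
    ext u : 1
    exact (rowOp_matOp _ _ _).trans (rowOp_diagOp _ _ _)
  rw [h]
  exact hT.comp_clm _

theorem norm_sum_smul_sq_le {n : ℕ} (w : Fin n → ℝ) (x : Fin n → G) :
    ‖∑ i, w i • x i‖ ^ 2 ≤ (∑ i, w i ^ 2) * ∑ i, ‖x i‖ ^ 2 := by
  have h1 : ‖∑ i, w i • x i‖ ≤ ∑ i, |w i| * ‖x i‖ :=
    (norm_sum_le _ _).trans_eq (Finset.sum_congr rfl fun i _ => norm_smul _ _)
  calc ‖∑ i, w i • x i‖ ^ 2 ≤ (∑ i, |w i| * ‖x i‖) ^ 2 := by gcongr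
    _ ≤ (∑ i, |w i| ^ 2) * ∑ i, ‖x i‖ ^ 2 := Finset.sum_mul_sq_le_sq_mul_sq _ _ _
    _ = _ := by simp only [sq_abs]

theorem rowOp_vecMul_eq {n : ℕ} (w : Fin n → ℝ) (C : Matrix (Fin n) (Fin N) ℝ)
    (u : PiLp 2 fun _ : Fin N => G) :
    rowOp G (Matrix.vecMul w C) u = ∑ i, w i • matAct C u.ofLp i := by
  simp only [rowOp_apply, matAct, Matrix.vecMul, dotProduct, Finset.smul_sum,
    Finset.sum_smul, smul_smul]
  exact Finset.sum_comm

end Componentwise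

/-! ### From strong to weak solutions -/

section WeakSolution

open scoped RealInnerProductSpace

variable {V H : Type*} [NormedAddCommGroup V] [InnerProductSpace ℝ V] [CompleteSpace V]
  [NormedAddCommGroup H] [InnerProductSpace ℝ H] {N : ℕ}

/-- The damping `D 𝓖` as an operator on `V^N`, through the Riesz representation of `g`. -/
noncomputable def dampingOp (g : V →L[ℝ] StrongDual ℝ V) (D : Matrix (Fin N) (Fin N) ℝ) :
    PiLp 2 (fun _ : Fin N => V) →L[ℝ] PiLp 2 (fun _ : Fin N => V) :=
  matOp V D ∘L diagOp N (InnerProductSpace.continuousLinearMapOfBilin (𝕜 := ℝ) g)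

theorem dampingOp_inner_nonneg {g : V →L[ℝ] StrongDual ℝ V} (hg : ∀ u, 0 ≤ g u u)
    {D : Matrix (Fin N) (Fin N) ℝ} (hD : D.PosSemidef) (u : PiLp 2 fun _ : Fin N => V) :
    0 ≤ ⟪dampingOp g D u, u⟫ :=
  matOp_inner_nonneg hD
    (fun x => by rw [InnerProductSpace.continuousLinearMapOfBilin_apply]; exact hg x) u

/-- Strong solutions of the abstract equation on `V^N` are weak solutions of the system. -/
theorem IsStrongSolution.isWeakSolution {ι : V →L[ℝ] H} {g : V →L[ℝ] StrongDual ℝ V}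
    {A D : Matrix (Fin N) (Fin N) ℝ} {U Y : ℝ → PiLp 2 (fun _ : Fin N => V)}
    {Z : ℝ → PiLp 2 (fun _ : Fin N => H)}
    (h : IsStrongSolution (diagOp N ι) (matOp H A) (dampingOp g D) U Y Z) :
    IsWeakSolution ι g A D (U 0).ofLp (diagOp N ι (Y 0)).ofLp
      (fun t => (U t).ofLp) (fun t => (diagOp N ι (Y t)).ofLp) where
  continuousOn := (PiLp.continuous_ofLp 2 _).comp_continuousOn
    fun t ht => (h.deriv_position t ht).continuousWithinAt
  hasDerivWithinAt t ht := (PiLp.continuousLinearEquiv 2 ℝ fun _ : Fin N => H).hasFDerivAt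
    |>.comp_hasDerivWithinAt t (h.hasDerivWithinAt_embedding ht)
  continuousOn_deriv := (PiLp.continuous_ofLp 2 _).comp_continuousOn
    fun t ht => (h.deriv_velocity t ht).continuousWithinAt
  initial := rfl
  initial_deriv := rfl
  weak i φ t ht := by
    have hU : ∀ j, HasDerivWithinAt (fun s => g (U s j) φ) (g (Y t j) φ) (Set.Ici 0) t := fun j =>
      ((ContinuousLinearMap.apply ℝ ℝ φ ∘L g ∘L PiLp.proj 2 (fun _ : Fin N => V) j).hasFDerivAt
        |>.comp_hasDerivWithinAt t (h.deriv_position t ht))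
    have hY : HasDerivWithinAt (fun s => ⟪diagOp N ι (Y s) i, ι φ⟫) ⟪Z t i, ι φ⟫ (Set.Ici 0) t := by
      have h1 := (PiLp.proj 2 (fun _ : Fin N => H) i).hasFDerivAt
        |>.comp_hasDerivWithinAt t (h.deriv_velocity t ht)
      simpa using h1.inner ℝ (hasDerivWithinAt_const t (Set.Ici 0) (ι φ))
    have hsum := hY.add (HasDerivWithinAt.fun_sum (u := Finset.univ)
      fun j _ => (hU j).const_mul (D i j))
    have hfun : (fun s => pivot ι ((diagOp N ι (Y s)).ofLp i) φ
        + matAct D (fun j => g ((U s).ofLp j)) i φ) =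
        fun s => ⟪diagOp N ι (Y s) i, ι φ⟫ + ∑ j, D i j * g (U s j) φ := by
      funext s
      simp [pivot, matAct]
    rw [hfun]
    refine hsum.congr_deriv ?_
    have e := h.equation t ht (colOp V (Pi.single i 1) φ)
    rw [diagOp_colOp] at e
    simp only [inner_colOp, rowOp_apply, Pi.single_apply, ite_smul, one_smul, zero_smul,
      Finset.sum_ite_eq', Finset.mem_univ, if_true, dampingOp, ContinuousLinearMap.comp_apply,
      matOp_apply, diagOp_apply, sum_inner, inner_smul_left, conj_trivial,
      InnerProductSpace.continuousLinearMapOfBilin_apply] at e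
    have e2 : pivot ι (matAct A (fun j => ι (U t j)) i) φ = ∑ j, A i j * ⟪ι (U t j), ι φ⟫ := by
      change ⟪∑ j, A i j • ι (U t j), ι φ⟫ = _
      simp only [sum_inner, inner_smul_left, conj_trivial]
    have e3 : dualityMap V (U t i) φ = ⟪U t i, φ⟫ := rfl
    rw [e2, e3]
    linarith

end WeakSolution

/-! ### The rank condition -/

open scoped RealInnerProductSpace in
/-- A nonzero combination `c` of the components that is annihilated by `D` obeys an undamped
equation, so it does not decay uniformly exponentially. -/
theorem not_uniform_decay_of_vecMul_eq_zero {V H : Type*}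
    [NormedAddCommGroup V] [InnerProductSpace ℝ V] [CompleteSpace V]
    [NormedAddCommGroup H] [InnerProductSpace ℝ H] [CompleteSpace H]
    (hV : ¬ FiniteDimensional ℝ V) {ι : V →L[ℝ] H} (hι_inj : Function.Injective ι)
    (hι_dense : DenseRange ι) (hι_compact : IsCompactOperator ι)
    {g : V →L[ℝ] StrongDual ℝ V} (hg_nonneg : ∀ u : V, 0 ≤ g u u) {N : ℕ}
    {A D : Matrix (Fin N) (Fin N) ℝ} (hA : A.PosSemidef) (hD : D.PosSemidef)
    {c : Fin N → ℝ} (hc : c ≠ 0) (hcD : Matrix.vecMul c D = 0) {K ω : ℝ} (hω : 0 < ω)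
    (hdecay : ∀ (U₀ : Fin N → V) (U₁ : Fin N → H) (U : ℝ → Fin N → V) (U' : ℝ → Fin N → H),
      IsWeakSolution ι g A D U₀ U₁ U U' → ∀ t : ℝ, 0 ≤ t →
        ‖∑ j, c j • U t j‖ ^ 2 + ‖∑ j, c j • U' t j‖ ^ 2 ≤
          K * Real.exp (-ω * t) * energyNorm U₀ U₁ ^ 2) : False := by
  have hP : IsUndampedProjection ι (diagOp N ι) (dampingOp g D) (rowOp V c) (rowOp H c)
      (colOp V c) :=
    { embedding := fun u => (rowOp_diagOp c ι u).symm
      inner_adjoint := inner_colOp c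
      inner_embedding_adjoint := fun z φ => by rw [diagOp_colOp, inner_colOp]
      inner_damping := fun y φ => by
        rw [inner_colOp, dampingOp, ContinuousLinearMap.comp_apply, rowOp_matOp, hcD]
        simp }
  have hκ : ∑ j, c j * c j ≠ 0 := by
    rw [Ne, ← dotProduct, dotProduct_self_eq_zero]
    exact hc
  refine hP.not_uniform_decay (A := matOp H A) (S := (∑ j, c j * c j)⁻¹ • colOp V c) (C := K)
    (ω := ω) hV (diagOp_injective hι_inj) (denseRange_diagOp hι_dense) ?_
    (matOp_inner_symm hA.isHermitian) (dampingOp_inner_nonneg hg_nonneg hD)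
    (isCompactOperator_rowOp_matOp_diagOp c A hι_compact) ?_ hω ?_
  · intro x
    exact matOp_inner_nonneg hA (T := ContinuousLinearMap.id ℝ H)
      (fun x => real_inner_self_nonneg) x
  · intro v
    have h : rowOp V c (colOp V c v) = (∑ j, c j * c j) • v := by
      simp [smul_smul, Finset.sum_smul]
    change rowOp V c ((∑ j, c j * c j)⁻¹ • colOp V c v) = v
    rw [map_smul, h, smul_smul, inv_mul_cancel₀ hκ, one_smul]
  · intro U Y Z h t ht
    have h1 := hdecay _ _ _ _ h.isWeakSolution t ht
    rw [energyNorm, Real.sq_sqrt (by positivity), Finset.sum_add_distrib,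
      ← PiLp.norm_sq_eq_of_L2, ← PiLp.norm_sq_eq_of_L2] at h1
    simpa only [rowOp_apply] using h1

theorem theorem2p5
    {V H : Type*}
    [NormedAddCommGroup V] [InnerProductSpace ℝ V] [CompleteSpace V]
    [NormedAddCommGroup H] [InnerProductSpace ℝ H] [CompleteSpace H]
    -- the spaces are infinite-dimensional
    (hV : ¬ FiniteDimensional ℝ V)
    -- the dense and compact embedding `V ⊂ H`
    (ι : V →L[ℝ] H) (hι_inj : Function.Injective ι) (hι_dense : DenseRange ι)
    (hι_compact : IsCompactOperator ι)
    -- the damping operator `g : V → V'`: continuous, linear, symmetric, semi-positive definite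
    (g : V →L[ℝ] StrongDual ℝ V) (hg_symm : ∀ u v : V, g u v = g v u)
    (hg_nonneg : ∀ u : V, 0 ≤ g u u)
    {N q : ℕ} (hq : q < N)
    -- symmetric and semi-positive definite coupling matrices
    (A D : Matrix (Fin N) (Fin N) ℝ) (hA : A.PosSemidef) (hD : D.PosSemidef)
    -- a matrix of full row rank
    (C : Matrix (Fin (N - q)) (Fin N) ℝ) (hC : C.rank = N - q)
    -- the decay estimate, for all solutions of the system
    (hdecay : ∃ M ω : ℝ, 1 ≤ M ∧ 0 < ω ∧
      ∀ (U₀ : Fin N → V) (U₁ : Fin N → H) (U : ℝ → Fin N → V) (U' : ℝ → Fin N → H),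
        IsWeakSolution ι g A D U₀ U₁ U U' →
          ∀ t : ℝ, 0 ≤ t →
            energyNorm (matAct C (U t)) (matAct C (U' t)) ≤
              M * Real.exp (-ω * t) * energyNorm U₀ U₁) :
    N - q ≤ (C * D).rank := by
  by_contra hrank
  -- a left null vector of `C D`, which is not a left null vector of `C`
  obtain ⟨w, hw0, hw⟩ : ∃ w : Fin (N - q) → ℝ, w ≠ 0 ∧ Matrix.vecMul w (C * D) = 0 := by
    by_contra! h
    refine hrank (le_of_eq ?_)
    have hli : LinearIndependent ℝ (C * D).row := by
      refine Matrix.vecMul_injective_iff.1 fun x y hxy => ?_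
      by_contra hne
      exact h (x - y) (sub_ne_zero.2 hne) (by rw [Matrix.sub_vecMul]; exact sub_eq_zero.2 hxy)
    rw [hli.rank_matrix, Fintype.card_fin]
  have hCinj : Function.Injective fun v => Matrix.vecMul v C := by
    rw [Matrix.vecMul_injective_iff, linearIndependent_iff_card_eq_finrank_span,
      Fintype.card_fin]
    exact hC.symm.trans C.rank_eq_finrank_span_row
  have hc : Matrix.vecMul w C ≠ 0 := fun h0 => hw0 (hCinj (by simpa using h0))
  obtain ⟨M, ω, hM, hω, hdec⟩ := hdecay
  refine not_uniform_decay_of_vecMul_eq_zero hV hι_inj hι_dense hι_compact hg_nonneg hA hD hc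
    (by rw [Matrix.vecMul_vecMul, hw]) (K := (∑ i, w i ^ 2) * M ^ 2) (ω := 2 * ω)
    (by positivity) fun U₀ U₁ U U' hU t ht => ?_
  have h1 := hdec U₀ U₁ U U' hU t ht
  have h2 : energyNorm (matAct C (U t)) (matAct C (U' t)) ^ 2 ≤
      (M * Real.exp (-ω * t) * energyNorm U₀ U₁) ^ 2 :=
    pow_le_pow_left₀ (Real.sqrt_nonneg _) h1 2
  have h3 : energyNorm (matAct C (U t)) (matAct C (U' t)) ^ 2 =
      ∑ i, ‖matAct C (U t) i‖ ^ 2 + ∑ i, ‖matAct C (U' t) i‖ ^ 2 := by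
    rw [energyNorm, Real.sq_sqrt (by positivity), Finset.sum_add_distrib]
  have h4 : Real.exp (-(2 * ω) * t) = Real.exp (-ω * t) ^ 2 := by
    rw [← Real.exp_nat_mul]
    congr 1
    push_cast
    ring
  have h5 : ∑ j, Matrix.vecMul w C j • U t j = ∑ i, w i • matAct C (U t) i := by
    simpa using rowOp_vecMul_eq w C (WithLp.toLp 2 (U t))
  have h6 : ∑ j, Matrix.vecMul w C j • U' t j = ∑ i, w i • matAct C (U' t) i := by
    simpa using rowOp_vecMul_eq w C (WithLp.toLp 2 (U' t))
  rw [h5, h6, h4]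
  calc ‖∑ i, w i • matAct C (U t) i‖ ^ 2 + ‖∑ i, w i • matAct C (U' t) i‖ ^ 2
      ≤ (∑ i, w i ^ 2) * energyNorm (matAct C (U t)) (matAct C (U' t)) ^ 2 := by
        rw [h3, mul_add]
        exact add_le_add (norm_sum_smul_sq_le _ _) (norm_sum_smul_sq_le _ _)
    _ ≤ (∑ i, w i ^ 2) * (M * Real.exp (-ω * t) * energyNorm U₀ U₁) ^ 2 := by gcongr
    _ = _ := by ring
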